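/- Let $V\subset\mathbb{C}^s$ be an affine toric variety: an irreducible affine variety containing, as a Zariski dense open subset, a torus $T$ (so $T\simeq(\mathbb{C}^*)^n$ as a variety and as a group, for some $n$), such that the action of $T$ on itself by multiplication extends to an algebraic action $T\times V\to V$. Let $M$ be the character lattice of $T$ (the group of morphisms $\chi^m:T\to\mathbb{C}^*$ that are group homomorphisms, written additively), $N=\operatorname{Hom}_{\mathbb{Z}}(M,\mathbb{Z})$ its cocharacter lattice, $N_{\mathbb{R}}=N\otimes_{\mathbb{Z}}\mathbb{R}$ and $M_{\mathbb{R}}=\operatorname{Hom}_{\mathbb{R}}(N_{\mathbb{R}},\mathbb{R})$. For a finitely generated submonoid (affine semigroup) $\mathcal{S}\subset M$, let $\mathbb{C}[\mathcal{S}]$ be its semigroup algebra, with basis $\{\chi^m : m\in \mathcal{S}\}$; $\mathcal{S}$ is saturated if $km\in\mathcal{S}$ with $k\in\mathbb{N}_{>0}$, $m\in M$ implies $m\in\mathcal{S}$. A rational cone in $N_{\mathbb{R}}$ is a cone $\sigma$ generated by a finite subset of $N$; it is strongly convex if $\sigma\cap(-\sigma)=\{0\}$, and $U_\sigma=\operatorname{Specm}(\mathbb{C}[\mathcal{S}_\sigma])$,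 where $\mathcal{S}_\sigma=\sigma^\vee\cap M$ and $\sigma^\vee\subset M_{\mathbb{R}}$ is the dual cone. The following are equivalent. 1. $V$ is normal, that is, its coordinate ring $\mathbb{C}[V]$ is integrally closed in its field of fractions. 2. $V=\operatorname{Specm}(\mathbb{C}[\mathcal{S}])$ for a saturated affine semigroup $\mathcal{S}\subset M$. 3. $V\simeq U_\sigma$ for some strongly convex rational cone $\sigma\subset N_{\mathbb{R}}$. Here $V=\operatorname{Specm}(\mathbb{C}[\mathcal{S}])$ means that there is an isomorphism of affine varieties under which each $\chi^m\in\mathbb{C}[\mathcal{S}]$ becomes a regular function on $V$ that restricts to the character $\chi^m$ on $T$, and $\simeq$ denotes isomorphism of affine varieties. Moreover, conditions 1, 2 and 3 are also equivalent to condition 2 with $=$ replaced by $\simeq$, and to condition 3 with $\simeq$ replaced by $=$. -/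

import Mathlib

open MvPolynomial TensorProduct

noncomputable section

namespace AffineToric

/-! ### Affine varieties and regular maps -/

/-- An affine variety in `ℂ^s`: the common zero set of finitely many polynomials. -/
def IsAffineVariety {s : ℕ} (V : Set (Fin s → ℂ)) : Prop :=
  ∃ F : Finset (MvPolynomial (Fin s) ℂ), V = {x | ∀ f ∈ F, eval x f = 0}

/-- Irreducibility in the Zariski topology. -/
def IsIrreducibleVariety {s : ℕ} (V : Set (Fin s → ℂ)) : Prop :=
  V.Nonempty ∧ ∀ Z₁ Z₂ : Set (Fin s → ℂ), IsAffineVariety Z₁ → IsAffineVariety Z₂ →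
    V ⊆ Z₁ ∪ Z₂ → V ⊆ Z₁ ∨ V ⊆ Z₂

/-- `T ⊆ V` is Zariski open in `V`. -/
def IsZariskiOpenIn {s : ℕ} (V T : Set (Fin s → ℂ)) : Prop :=
  ∃ Z : Set (Fin s → ℂ), IsAffineVariety Z ∧ T = V \ Z

/-- `T ⊆ V` is Zariski dense in `V`. -/
def IsZariskiDenseIn {s : ℕ} (V T : Set (Fin s → ℂ)) : Prop :=
  ∀ Z : Set (Fin s → ℂ), IsAffineVariety Z → T ⊆ Z → V ⊆ Z

/-- Let `X` be a quasi-affine variety, given by the coordinates `c : X → ℂ^ι` of its points.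
A function on `X` is regular if near every point (on a basic Zariski open neighbourhood) it is a
quotient of two polynomials in the coordinates. -/
def IsRegularFun {X ι : Type*} (c : X → ι → ℂ) (f : X → ℂ) : Prop :=
  ∀ x : X, ∃ p q : MvPolynomial ι ℂ, eval (c x) q ≠ 0 ∧
    ∀ y : X, eval (c y) q ≠ 0 → f y = eval (c y) p / eval (c y) q

/-- A map of quasi-affine varieties (given by coordinates `c` and `d`) is a morphism if all its
coordinate functions are regular. -/
def IsRegularMap {X Y ι κ : Type*} (c : X → ι → ℂ) (d : Y → κ → ℂ) (f : X → Y) : Prop :=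
  ∀ j : κ, IsRegularFun c (fun x => d (f x) j)

/-- The coordinates of a point of a subset of `ℂ^s`. -/
def coords {s : ℕ} (V : Set (Fin s → ℂ)) : V → Fin s → ℂ := fun x => x.1

/-- The coordinates of a point of `(ℂ^*)^n`, an open subset of `ℂ^n`. -/
def torusCoords (n : ℕ) : (Fin n → ℂˣ) → Fin n → ℂ := fun t i => (t i : ℂ)

/-- The coordinates of a point of a product. -/
def prodCoords {X Y ι κ : Type*} (c : X → ι → ℂ) (d : Y → κ → ℂ) : X × Y → ι ⊕ κ → ℂ :=
  fun z => Sum.elim (c z.1) (d z.2)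

/-- The coordinate ring `ℂ[V] = ℂ[x₁, …, x_s] / I(V)`. -/
abbrev CoordRing {s : ℕ} (V : Set (Fin s → ℂ)) : Type :=
  MvPolynomial (Fin s) ℂ ⧸ vanishingIdeal ℂ V

/-- The value of an element of the coordinate ring at a point of `V`. -/
def evalAt {s : ℕ} {V : Set (Fin s → ℂ)} (x : V) : CoordRing V →ₐ[ℂ] ℂ :=
  Ideal.Quotient.liftₐ (vanishingIdeal ℂ V) (aeval x.1) (fun _ hp => hp x.1 x.2)

/-- An irreducible affine variety is normal if its coordinate ring (a domain) is integrally closed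
in its field of fractions. -/
def IsNormalVariety {s : ℕ} (V : Set (Fin s → ℂ)) : Prop :=
  IsIntegrallyClosed (CoordRing V)

/-- An isomorphism of affine varieties `V ≃ Specm R`: a homeomorphism `V ≃ Specm R` for the Zariski
topologies together with an isomorphism of `ℂ`-algebras `R ≃ ℂ[V]`, such that an element of `R`
vanishes at a point of `Specm R` (that is, lies in that maximal ideal) if and only if the
corresponding function vanishes at the corresponding point of `V`. -/
structure SpecmIso {s : ℕ} (V : Set (Fin s → ℂ)) (R : Type*) [CommRing R] [Algebra ℂ R] where
  toAlgEquiv : R ≃ₐ[ℂ] CoordRing V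
  toEquiv : V ≃ MaximalSpectrum R
  isClosed_image_iff : ∀ Z : Set (Fin s → ℂ), Z ⊆ V →
    (IsClosed (toEquiv '' {x : V | x.1 ∈ Z}) ↔ IsAffineVariety Z)
  mem_iff : ∀ (x : V) (r : R), r ∈ (toEquiv x).asIdeal ↔ evalAt x (toAlgEquiv r) = 0

/-! ### Affine toric varieties -/

/-- An affine toric variety in `ℂ^s`: an irreducible affine variety `V` containing a torus `T` as a
Zariski dense open subset such that the action of `T` on itself extends to an algebraic action of
`T` on `V`. -/
structure AffineToricVariety (s : ℕ) where
  V : Set (Fin s → ℂ)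
  isAffineVariety : IsAffineVariety V
  irreducible : IsIrreducibleVariety V
  T : Set (Fin s → ℂ)
  subset : T ⊆ V
  isOpen : IsZariskiOpenIn V T
  dense : IsZariskiDenseIn V T
  /-- the group structure of the torus -/
  [group : Group T]
  /-- `T` is a torus: it is isomorphic to some `(ℂ^*)^n`, as a variety and as a group. -/
  torus : ∃ (n : ℕ) (φ : (Fin n → ℂˣ) ≃* T),
    IsRegularMap (torusCoords n) (coords T) φ ∧ IsRegularMap (coords T) (torusCoords n) φ.symm
  /-- The multiplication of `T` extends to an action `T × V → V` that is a morphism. -/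
  action : ∃ act : T × V → V,
    IsRegularMap (prodCoords (coords T) (coords V)) (coords V) act ∧
    (∀ x : V, act (1, x) = x) ∧
    (∀ (t t' : T) (x : V), act (t * t', x) = act (t, act (t', x))) ∧
    ∀ t t' : T, act (t, ⟨t'.1, subset t'.2⟩) = ⟨(t * t').1, subset (t * t').2⟩

attribute [instance] AffineToricVariety.group

theorem isRegularFun_one {X ι : Type*} (c : X → ι → ℂ) : IsRegularFun c (fun _ => 1) :=
  fun _ => ⟨1, 1, by simp, fun y _ => by simp⟩

theorem IsRegularFun.mul {X ι : Type*} {c : X → ι → ℂ} {f g : X → ℂ} (hf : IsRegularFun c f)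
    (hg : IsRegularFun c g) : IsRegularFun c (fun x => f x * g x) := by
  intro x
  obtain ⟨p, q, hq, h⟩ := hf x
  obtain ⟨p', q', hq', h'⟩ := hg x
  refine ⟨p * p', q * q', by simp [hq, hq'], fun y hy => ?_⟩
  rw [map_mul] at hy
  change f y * g y = _
  rw [h y (left_ne_zero_of_mul hy), h' y (right_ne_zero_of_mul hy), map_mul, map_mul,
    div_mul_div_comm]

theorem IsRegularFun.inv {X ι : Type*} {c : X → ι → ℂ} {f : X → ℂ} (hf : IsRegularFun c f)
    (h0 : ∀ x, f x ≠ 0) : IsRegularFun c (fun x => (f x)⁻¹) := by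
  intro x
  obtain ⟨p, q, hq, h⟩ := hf x
  have hp : eval (c x) p ≠ 0 := fun hp => h0 x (by rw [h x hq, hp, zero_div])
  refine ⟨q * q, p * q, by simp [hq, hp], fun y hy => ?_⟩
  rw [map_mul] at hy
  have hqy := right_ne_zero_of_mul hy
  have hpy := left_ne_zero_of_mul hy
  change (f y)⁻¹ = _
  rw [h y hqy, map_mul, map_mul]
  field_simp

namespace AffineToricVariety

variable {s : ℕ} (X : AffineToricVariety s)

/-- The group of characters of the torus: morphisms `T → ℂ^*` that are group homomorphisms. -/
def characterGroup : Subgroup (X.T →* ℂˣ) where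
  carrier := {χ | IsRegularFun (coords X.T) (fun t => (χ t : ℂ))}
  one_mem' := by simpa using isRegularFun_one (coords X.T)
  mul_mem' {χ ψ} hχ hψ := by simpa using IsRegularFun.mul hχ hψ
  inv_mem' {χ} hχ := by simpa using IsRegularFun.inv hχ (fun t => (χ t).ne_zero)

/-- The character lattice `M` of the torus, written additively. -/
abbrev M : Type := Additive X.characterGroup

/-- The character `χ^m : T → ℂ^*` of a lattice point `m ∈ M`. -/
def char (m : X.M) : X.T →* ℂˣ := (Additive.toMul m).1

/-- The cocharacter lattice `N = Hom_ℤ(M, ℤ)`. -/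
abbrev N : Type := Module.Dual ℤ X.M

/-- `N_ℝ = ℝ ⊗ N`. -/
abbrev NReal : Type := ℝ ⊗[ℤ] X.N

/-- `M_ℝ = Hom_ℝ(N_ℝ, ℝ)`. -/
abbrev MReal : Type := Module.Dual ℝ X.NReal

/-- The canonical map `M → M_ℝ`; it sends `m` to the linear form `a ⊗ u ↦ a * ⟨m, u⟩`. -/
def toMReal : X.M →+ X.MReal where
  toFun m := TensorProduct.AlgebraTensorModule.lift
    ((LinearMap.lsmul ℝ (X.N →ₗ[ℤ] ℝ)).flip
      ((Algebra.linearMap ℤ ℝ).comp (Module.Dual.eval ℤ X.M m)))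
  map_zero' := by ext u; simp
  map_add' m m' := by ext u; simp

theorem toMReal_tmul (m : X.M) (a : ℝ) (u : X.N) : X.toMReal m (a ⊗ₜ[ℤ] u) = a * (u m : ℤ) := by
  simp [toMReal]

/-- A rational (convex polyhedral) cone in `N_ℝ`: the cone generated by a finite subset of `N`. -/
def IsRationalCone (σ : PointedCone ℝ X.NReal) : Prop :=
  ∃ S : Finset X.N, σ = PointedCone.hull ℝ ((fun u : X.N => (1 : ℝ) ⊗ₜ[ℤ] u) '' S)

/-- Strong convexity: `σ ∩ (-σ) = {0}`. -/
def IsStronglyConvex (σ : PointedCone ℝ X.NReal) : Prop :=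
  {x : X.NReal | x ∈ σ ∧ -x ∈ σ} = {0}

/-- The dual cone `σ^∨` in `M_ℝ`. -/
def dualCone (σ : PointedCone ℝ X.NReal) : PointedCone ℝ X.MReal :=
  PointedCone.dual (Module.Dual.eval ℝ X.NReal) (σ : Set X.NReal)

/-- The semigroup `S_σ = σ^∨ ∩ M`. -/
def coneSemigroup (σ : PointedCone ℝ X.NReal) : AddSubmonoid X.M :=
  (X.dualCone σ).toAddSubmonoid.comap X.toMReal

/-- A saturated affine semigroup in `M`: a finitely generated submonoid `S` of `M` such that
`k m ∈ S` with `k > 0` and `m ∈ M` implies `m ∈ S`. -/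
def IsSaturatedAffineSemigroup (S : AddSubmonoid X.M) : Prop :=
  S.FG ∧ ∀ (k : ℕ) (m : X.M), 0 < k → k • m ∈ S → m ∈ S

/-- `V ≃ Specm ℂ[S]`: the two affine varieties are isomorphic. -/
def IsoSpecm (S : AddSubmonoid X.M) : Prop :=
  Nonempty (SpecmIso X.V (AddMonoidAlgebra ℂ S))

/-- `V = Specm ℂ[S]`: the affine varieties are identified in such a way that each element `χ^m` of
`ℂ[S]`, `m ∈ S`, is a regular function on `V` whose restriction to `T` is the character `χ^m`. -/
def EqSpecm (S : AddSubmonoid X.M) : Prop :=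
  ∃ e : SpecmIso X.V (AddMonoidAlgebra ℂ S), ∀ (m : S) (t : X.T),
    evalAt ⟨t.1, X.subset t.2⟩ (e.toAlgEquiv (AddMonoidAlgebra.single m 1)) = (X.char m t : ℂ)

end AffineToricVariety

end AffineToric

end

/-! Restriction to the dense torus embeds `ℂ[V]` in the functions on `T`. Regular functions on `T`
are combinations of characters, and characters are linearly independent. The image of `ℂ[V]` is
stable under translation by `T`, so it contains every character occurring in one of its elements.
Hence `ℂ[V] = ℂ[S]` for `S = X.extendingSemigroup`; `S` is finitely generated because `ℂ[V]` is, and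
it generates `M` as a group because characters are fractions of elements of `ℂ[V]`
(`exists_add_mem_extendingSemigroup`).

If `V` is normal, then `S` is saturated, since a fraction `χ^m` with a power in `ℂ[V]` lies in
`ℂ[V]`. By the lemmas of Farkas and Gordan, `S` is then the semigroup of a rational cone, strongly
convex because `S` generates `M` (`exists_coneSemigroup_eq`).

Conversely, if `S` is saturated, `ℂ[S]` is integrally closed in the Laurent polynomial ring `ℂ[M]`,
which is normal (`isIntegrallyClosed_addMonoidAlgebra`). Normality depends only on the ring, so a
mere isomorphism `V ≃ Specm ℂ[S]` is enough. -/

noncomputable section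

namespace AffineToric

/-! ### Regular functions -/

section Regular

variable {X Y ι κ : Type*} {c : X → ι → ℂ} {d : Y → κ → ℂ}

theorem isRegularFun_eval (c : X → ι → ℂ) (p : MvPolynomial ι ℂ) :
    IsRegularFun c (fun x => eval (c x) p) :=
  fun _ => ⟨p, 1, by simp, fun y _ => by simp⟩

theorem IsRegularFun.add {f g : X → ℂ} (hf : IsRegularFun c f) (hg : IsRegularFun c g) :
    IsRegularFun c (fun x => f x + g x) := by
  intro x
  obtain ⟨p, q, hq, h⟩ := hf x
  obtain ⟨p', q', hq', h'⟩ := hg x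
  refine ⟨p * q' + q * p', q * q', by simp [hq, hq'], fun y hy => ?_⟩
  rw [map_mul] at hy
  have hy1 := left_ne_zero_of_mul hy
  have hy2 := right_ne_zero_of_mul hy
  change f y + g y = _
  rw [h y hy1, h' y hy2, div_add_div _ _ hy1 hy2]
  simp

theorem isRegularFun_eval_of_forall {g : X → κ → ℂ} (hg : ∀ j, IsRegularFun c fun x => g x j)
    (p : MvPolynomial κ ℂ) : IsRegularFun c (fun x => eval (g x) p) := by
  induction p using MvPolynomial.induction_on with
  | C a => simpa using isRegularFun_eval c (C a)
  | add p q hp hq => simpa using hp.add hq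
  | mul_X p j hp => simpa using hp.mul (hg j)

theorem IsRegularFun.comp {f : Y → ℂ} {φ : X → Y} (hf : IsRegularFun d f)
    (hφ : IsRegularMap c d φ) : IsRegularFun c (fun x => f (φ x)) := by
  intro x
  obtain ⟨p, q, hq, h⟩ := hf (φ x)
  obtain ⟨p₁, q₁, hq₁, h₁⟩ := isRegularFun_eval_of_forall hφ p x
  obtain ⟨p₂, q₂, hq₂, h₂⟩ := isRegularFun_eval_of_forall hφ q x
  have hp₂ : eval (c x) p₂ ≠ 0 := by
    intro h0
    apply hq
    have := h₂ x hq₂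
    simpa [h0] using this
  -- The quotient is `(p₁ / q₁) / (p₂ / q₂)`; the extra factor `q₂` forces `q₂ ≠ 0` on the
  -- neighbourhood.
  refine ⟨p₁ * q₂ * q₂, q₁ * p₂ * q₂, by simp [hq₁, hp₂, hq₂], fun y hy => ?_⟩
  simp only [map_mul, mul_ne_zero_iff] at hy
  obtain ⟨⟨hy1, hy2⟩, hy3⟩ := hy
  have h2y := h₂ y hy3
  have h1y := h₁ y hy1
  change eval (fun j => d (φ y) j) p = _ at h1y
  change eval (fun j => d (φ y) j) q = _ at h2y
  change f (φ y) = _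
  rw [h (φ y) (by rw [h2y]; exact div_ne_zero hy2 hy3)]
  change (eval fun j => d (φ y) j) p / (eval fun j => d (φ y) j) q = _
  rw [h1y, h2y, div_div_div_eq]
  simp only [map_mul]
  exact (mul_div_mul_right _ _ hy3).symm

/-- The ideal of denominators of a function. -/
def denominatorIdeal (c : X → ι → ℂ) (f : X → ℂ) : Ideal (MvPolynomial ι ℂ) where
  carrier := {q | ∃ p, ∀ x, eval (c x) q * f x = eval (c x) p}
  zero_mem' := ⟨0, by simp⟩
  add_mem' := by
    rintro q q' ⟨p, hp⟩ ⟨p', hp'⟩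
    exact ⟨p + p', fun x => by rw [map_add, map_add, add_mul, hp, hp']⟩
  smul_mem' := by
    rintro a q ⟨p, hp⟩
    exact ⟨a * p, fun x => by rw [smul_eq_mul, map_mul, map_mul, mul_assoc, hp]⟩

/-- A regular function on the complement of the hypersurface `h = 0` in a closed set becomes
polynomial after multiplication by a power of `h`. -/
theorem IsRegularFun.exists_pow_mul_eq_eval [Finite ι] {f : X → ℂ} (hf : IsRegularFun c f)
    (h : MvPolynomial ι ℂ)
    (hc : ∀ y : ι → ℂ, (∀ p, (∀ x, eval (c x) p = 0) → eval y p = 0) → eval y h ≠ 0 →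
      y ∈ Set.range c) :
    ∃ (k : ℕ) (p : MvPolynomial ι ℂ), ∀ x, eval (c x) h ^ k * f x = eval (c x) p := by
  -- By the Nullstellensatz it suffices that `h` vanishes at every common zero of the denominators.
  -- Polynomials vanishing on `X` are denominators with numerator `0`, so a common zero with `h ≠ 0`
  -- is a point of `X`; but there a local expression of `f` supplies a nonvanishing denominator.
  have hmem : h ∈ vanishingIdeal ℂ (zeroLocus ℂ (denominatorIdeal c f)) := by
    intro y hy
    by_contra hne
    have hne' : eval y h ≠ 0 := by simpa [aeval_eq_eval] using hne
    obtain ⟨x, rfl⟩ := hc y (fun p hp => by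
      simpa [aeval_eq_eval] using hy p ⟨0, fun x => by simp [hp x]⟩) hne'
    obtain ⟨p, q, hq, hpq⟩ := hf x
    -- The square is needed: where `q = 0` nothing is known about `f`, but `q² f = q p` holds as `0
    -- = 0`.
    have hqq : q * q ∈ denominatorIdeal c f := by
      refine ⟨q * p, fun z => ?_⟩
      by_cases hz : eval (c z) q = 0
      · simp [hz]
      · rw [hpq z hz, map_mul, map_mul]
        field_simp
    have := hy _ hqq
    simp [aeval_eq_eval, hq] at this
  rw [vanishingIdeal_zeroLocus_eq_radical] at hmem
  obtain ⟨k, p, hp⟩ := hmem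
  exact ⟨k, p, fun x => by simpa using hp x⟩

end Regular

theorem IsAffineVariety.mem_of_forall {s : ℕ} {V : Set (Fin s → ℂ)} (hV : IsAffineVariety V)
    {y : Fin s → ℂ} (hy : ∀ p ∈ vanishingIdeal ℂ V, eval y p = 0) : y ∈ V := by
  obtain ⟨F, rfl⟩ := hV
  exact fun f hf => hy f fun x hx => by simpa [aeval_eq_eval] using hx f hf

theorem isAffineVariety_zeroLocus {s : ℕ} (I : Ideal (MvPolynomial (Fin s) ℂ)) :
    IsAffineVariety (zeroLocus ℂ I) := by
  obtain ⟨F, rfl⟩ := (isNoetherianRing_iff_ideal_fg _).1 inferInstance I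
  exact ⟨F, by rw [zeroLocus_span]; simp [aeval_eq_eval]⟩

/-- Regular functions on an affine variety are polynomial. -/
theorem IsRegularFun.exists_eq_eval {s : ℕ} {V : Set (Fin s → ℂ)} (hV : IsAffineVariety V)
    {f : V → ℂ} (hf : IsRegularFun (coords V) f) :
    ∃ p : MvPolynomial (Fin s) ℂ, ∀ x : V, f x = eval x.1 p := by
  obtain ⟨k, p, hp⟩ := hf.exists_pow_mul_eq_eval 1 fun y hy _ =>
    ⟨⟨y, hV.mem_of_forall fun p hp => hy p fun x => by
      simpa [aeval_eq_eval, coords] using hp x.1 x.2⟩, rfl⟩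
  exact ⟨p, fun x => by simpa [coords] using hp x⟩

/-! ### Points of affine varieties and maximal ideals -/

section Specm

variable {s : ℕ} {V : Set (Fin s → ℂ)}

theorem evalAt_mk (x : V) (p : MvPolynomial (Fin s) ℂ) :
    evalAt x (Ideal.Quotient.mk (vanishingIdeal ℂ V) p) = eval x.1 p := by
  simp [evalAt]

theorem evalAt_surjective (x : V) : Function.Surjective (evalAt x) :=
  fun a => ⟨algebraMap ℂ _ a, by simp⟩

/-- The Nullstellensatz gives a point for the preimage of `I` in the polynomial ring; it lies on `V`
because that preimage contains the ideal of `V`. -/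
theorem exists_ker_evalAt_eq (hV : IsAffineVariety V) (I : Ideal (CoordRing V)) [I.IsMaximal] :
    ∃ x : V, I = RingHom.ker (evalAt x) := by
  obtain ⟨y, hy⟩ := eq_vanishingIdeal_singleton_of_isMaximal ℂ
    (Ideal.comap_isMaximal_of_surjective (Ideal.Quotient.mk (vanishingIdeal ℂ V))
      Ideal.Quotient.mk_surjective (K := I))
  have hmem (p) : Ideal.Quotient.mk (vanishingIdeal ℂ V) p ∈ I ↔ eval y p = 0 := by
    rw [← Ideal.mem_comap, hy, mem_vanishingIdeal_singleton_iff]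
    simp [aeval_eq_eval]
  refine ⟨⟨y, hV.mem_of_forall fun p hp => ?_⟩, ?_⟩
  · rw [← hmem, Ideal.Quotient.eq_zero_iff_mem.2 hp]
    exact I.zero_mem
  · ext r
    obtain ⟨p, rfl⟩ := Ideal.Quotient.mk_surjective r
    rw [hmem, RingHom.mem_ker, evalAt_mk]

variable {R : Type*} [CommRing R] [Algebra ℂ R]

/-- The maximal ideal of a point. -/
def pointIdeal (e : R ≃ₐ[ℂ] CoordRing V) (x : V) : MaximalSpectrum R :=
  ⟨RingHom.ker ((evalAt x).comp (e : R →ₐ[ℂ] CoordRing V)),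
    RingHom.ker_isMaximal_of_surjective _ ((evalAt_surjective x).comp e.surjective)⟩

theorem mem_pointIdeal (e : R ≃ₐ[ℂ] CoordRing V) (x : V) (r : R) :
    r ∈ (pointIdeal e x).asIdeal ↔ evalAt x (e r) = 0 := by
  simp [pointIdeal, RingHom.mem_ker]

theorem pointIdeal_bijective (hV : IsAffineVariety V) (e : R ≃ₐ[ℂ] CoordRing V) :
    Function.Bijective (pointIdeal e) := by
  constructor
  · intro x y hxy
    ext i
    have h := (mem_pointIdeal e x (e.symm (Ideal.Quotient.mk _ (X i - C (x.1 i))))).2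
      (by rw [e.apply_symm_apply, evalAt_mk]; simp)
    rw [hxy, mem_pointIdeal, e.apply_symm_apply, evalAt_mk] at h
    simpa [sub_eq_zero, eq_comm (a := x.1 i)] using h
  · intro m
    have : (m.asIdeal.comap (e.symm : CoordRing V →+* R)).IsMaximal :=
      haveI := m.isMaximal
      Ideal.comap_isMaximal_of_surjective _ e.symm.surjective
    obtain ⟨x, hx⟩ := exists_ker_evalAt_eq hV (m.asIdeal.comap (e.symm : CoordRing V →+* R))
    refine ⟨x, MaximalSpectrum.ext ?_⟩
    ext r
    rw [mem_pointIdeal, ← RingHom.mem_ker, ← hx, Ideal.mem_comap]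
    simp

theorem isClosed_image_pointIdeal_iff (hV : IsAffineVariety V) (e : R ≃ₐ[ℂ] CoordRing V)
    {Z : Set (Fin s → ℂ)} (hZ : Z ⊆ V) :
    IsClosed (pointIdeal e '' {x : V | x.1 ∈ Z}) ↔ IsAffineVariety Z := by
  have key (A : Set R) (x : V) : pointIdeal e x ∈
      MaximalSpectrum.toPrimeSpectrum ⁻¹' PrimeSpectrum.zeroLocus A ↔
      ∀ r ∈ A, evalAt x (e r) = 0 := by
    simp only [Set.mem_preimage, PrimeSpectrum.mem_zeroLocus, ← mem_pointIdeal]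
    rfl
  rw [isClosed_induced_iff]
  constructor
  · rintro ⟨C, hC, hCZ⟩
    obtain ⟨A, rfl⟩ := (PrimeSpectrum.isClosed_iff_zeroLocus C).1 hC
    have hmem (x : V) : x.1 ∈ Z ↔ ∀ r ∈ A, evalAt x (e r) = 0 := by
      rw [← key, hCZ, (pointIdeal_bijective hV e).1.mem_set_image]
      rfl
    convert isAffineVariety_zeroLocus
      (Ideal.span {p | p ∈ vanishingIdeal ℂ V ∨ ∃ r ∈ A, Ideal.Quotient.mk _ p = e r}) using 1
    rw [zeroLocus_span]
    ext y
    constructor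
    · rintro hy p (hp | ⟨r, hr, hp⟩)
      · exact hp y (hZ hy)
      · have := (hmem ⟨y, hZ hy⟩).1 hy r hr
        rwa [← hp, evalAt_mk, ← aeval_eq_eval] at this
    · intro hy
      have hyV : y ∈ V := hV.mem_of_forall fun p hp => by
        simpa [aeval_eq_eval] using hy p (Or.inl hp)
      refine (hmem ⟨y, hyV⟩).2 fun r hr => ?_
      obtain ⟨p, hp⟩ := Ideal.Quotient.mk_surjective (e r)
      rw [← hp, evalAt_mk]
      simpa [aeval_eq_eval] using hy p (Or.inr ⟨r, hr, hp⟩)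
  · rintro ⟨F, rfl⟩
    refine ⟨PrimeSpectrum.zeroLocus ((fun f => e.symm (Ideal.Quotient.mk _ f)) '' F),
      PrimeSpectrum.isClosed_zeroLocus _, ?_⟩
    ext m
    obtain ⟨x, rfl⟩ := (pointIdeal_bijective hV e).2 m
    rw [key, (pointIdeal_bijective hV e).1.mem_set_image]
    simp [evalAt_mk]

/-- An isomorphism with the coordinate ring of an affine variety induces an isomorphism with
the maximal spectrum. -/
def SpecmIso.ofAlgEquiv (hV : IsAffineVariety V) (e : R ≃ₐ[ℂ] CoordRing V) : SpecmIso V R where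
  toAlgEquiv := e
  toEquiv := Equiv.ofBijective (pointIdeal e) (pointIdeal_bijective hV e)
  isClosed_image_iff _ hZ := isClosed_image_pointIdeal_iff hV e hZ
  mem_iff := mem_pointIdeal e

end Specm

/-! ### Lattices and cones -/

section Lattice

variable {L : Type*} [AddCommGroup L]

/-- **Gordan's lemma**: the lattice points of a rational polyhedral cone, given by finitely many
inequalities, form a finitely generated monoid. -/
theorem fg_of_forall_nonneg [Module.Free ℤ L] [Module.Finite ℤ L] {κ : Type*} [Finite κ]
    (u : κ → L →+ ℤ) (P : AddSubmonoid L) (hP : ∀ x, x ∈ P ↔ ∀ j, 0 ≤ u j x) : P.FG := by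
  let ι := Module.Free.ChooseBasisIndex ℤ L
  let b : Module.Basis ι ℤ L := Module.Free.chooseBasis ℤ L
  -- Positive and negative parts of the coordinates of a lattice point, and one slack variable per
  -- inequality. Then `P` is the image under `π` of the solutions of `u j (π a) = slack j`, an
  -- equalizer of two homomorphisms from a finite power of `ℕ`.
  let E := ι ⊕ ι ⊕ κ → ℕ
  let π : E →+ L :=
    { toFun a := ∑ i, ((a (.inl i) : ℤ) - a (.inr (.inl i))) • b i
      map_zero' := Finset.sum_eq_zero fun i _ => by
        rw [Pi.zero_apply, Pi.zero_apply, sub_self, zero_smul]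
      map_add' a a' := by
        rw [← Finset.sum_add_distrib]
        exact Finset.sum_congr rfl fun i _ => by
          rw [← add_smul]
          congr 1
          change ((a (.inl i) + a' (.inl i) : ℕ) : ℤ) -
            ((a (.inr (.inl i)) + a' (.inr (.inl i)) : ℕ) : ℤ) = _
          push_cast
          ring }
  let f : E →+ (κ → ℤ) := (AddMonoidHom.pi u).comp π
  let g : E →+ (κ → ℤ) := AddMonoidHom.pi fun j =>
    (Nat.castAddMonoidHom ℤ).comp (Pi.evalAddMonoidHom (fun _ => ℕ) (.inr (.inr j)))
  have h : P = (f.eqLocusM g).map π := by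
    ext x
    rw [hP, AddSubmonoid.mem_map]
    constructor
    · intro hx
      refine ⟨Sum.elim (fun i => (b.repr x i).toNat)
        (Sum.elim (fun i => (-b.repr x i).toNat) fun j => (u j x).toNat), ?_, ?_⟩
      all_goals
        have hπ : π (Sum.elim (fun i => (b.repr x i).toNat)
          (Sum.elim (fun i => (-b.repr x i).toNat) fun j => (u j x).toNat)) = x := by
          conv_rhs => rw [← b.sum_repr x]
          exact Finset.sum_congr rfl fun i _ => by
            congr 1; simp only [Sum.elim_inl, Sum.elim_inr]; omega
      · rw [AddMonoidHom.mem_eqLocusM]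
        ext j
        change u j (π _) = _
        rw [hπ]
        exact (Int.toNat_of_nonneg (hx j)).symm
      · exact hπ
    · rintro ⟨a, ha, rfl⟩ j
      have := congrFun (AddMonoidHom.mem_eqLocusM.1 ha) j
      change u j (π a) = ((a (.inr (.inr j)) : ℕ) : ℤ) at this
      rw [this]
      positivity
  rw [h]
  exact (AddSubmonoid.fg_eqLocusM f g).map π

/-- **Farkas' lemma** over the integers: a lattice point outside the cone generated by finitely
many lattice points is separated from it by an integral linear form. -/
theorem exists_dual_neg_of_nsmul_notMem_closure [Module.Free ℤ L] {ι : Type*} (t : Finset ι)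
    (v : ι → L) (w : L) (hw : ∀ k : ℕ, 0 < k → k • w ∉ AddSubmonoid.closure (v '' t)) :
    ∃ u : Module.Dual ℤ L, (∀ i ∈ t, 0 ≤ u (v i)) ∧ u w < 0 := by
  classical
  induction t using Finset.induction_on generalizing v w with
  | empty =>
    have hw0 : w ≠ 0 := fun h => hw 1 one_pos (by simp [h])
    obtain ⟨u, hu⟩ : ∃ u : Module.Dual ℤ L, u w ≠ 0 := by
      by_contra! h
      exact hw0 ((Module.forall_dual_apply_eq_zero_iff ℤ w).1 h)
    rcases lt_or_gt_of_ne hu with h | h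
    · exact ⟨u, by simp, h⟩
    · exact ⟨-u, by simp, by simpa using h⟩
  | insert a t ha ih =>
    have hsub : AddSubmonoid.closure (v '' t) ≤ AddSubmonoid.closure (v '' ↑(insert a t)) :=
      AddSubmonoid.closure_mono (Set.image_mono (by simp))
    have hmem (i) (hi : i ∈ insert a t) : v i ∈ AddSubmonoid.closure (v '' ↑(insert a t)) :=
      AddSubmonoid.subset_closure ⟨i, hi, rfl⟩
    obtain ⟨f, hf, hfw⟩ := ih v w fun k hk h => hw k hk (hsub h)
    by_cases hfa : 0 ≤ f (v a)
    · exact ⟨f, by simpa [hfa] using hf, hfw⟩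
    push Not at hfa
    -- Projection to the kernel of `f` along `v a`, scaled by `-f (v a) > 0` to stay integral. It
    -- kills `v a`, so a form pulled back along `r` vanishes there.
    let r : L →ₗ[ℤ] L := LinearMap.toSpanSingleton ℤ L (v a) ∘ₗ f - f (v a) • LinearMap.id
    have hr (x) : r x = f x • v a - f (v a) • x := by simp [r]
    obtain ⟨g, hg, hgw⟩ := ih (fun i => r (v i)) (r w) fun k hk h => by
      have h1 : k • r w ∈ AddSubmonoid.closure (v '' ↑(insert a t)) := by
        refine AddSubmonoid.closure_le.2 ?_ h
        rintro _ ⟨i, hi, rfl⟩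
        have hi' : i ∈ t := hi
        have e : r (v i) = (f (v i)).toNat • v a + (-f (v a)).toNat • v i := by
          rw [← natCast_zsmul (v a), ← natCast_zsmul (v i), Int.toNat_of_nonneg (hf i hi'),
            Int.toNat_of_nonneg (by omega), hr, neg_smul, sub_eq_add_neg]
        change r (v i) ∈ _
        rw [e]
        exact add_mem (nsmul_mem (hmem a (by simp)) _) (nsmul_mem (hmem i (by simp [hi'])) _)
      refine hw (k * (-f (v a)).toNat) (Nat.mul_pos hk (by omega)) ?_
      -- Solving the definition of `r w` for `w`: the coefficients are natural because `f w` and `f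
      -- (v a)` are negative.
      have e : (k * (-f (v a)).toNat) • w = k • r w + (k * (-f w).toNat) • v a := by
        rw [mul_smul, mul_smul, ← smul_add, ← natCast_zsmul w, ← natCast_zsmul (v a),
          Int.toNat_of_nonneg (by omega), Int.toNat_of_nonneg (by omega), hr]
        congr 1
        module
      rw [e]
      exact add_mem h1 (nsmul_mem (hmem a (by simp)) _)
    refine ⟨g ∘ₗ r, fun i hi => ?_, hgw⟩
    rcases Finset.mem_insert.1 hi with rfl | hi
    · simp [hr]
    · exact hg i hi

/-- Biduality: saturation turns the cone membership in Farkas' lemma into membership in `S` itself.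
-/
theorem mem_of_forall_dual_nonneg [Module.Free ℤ L] {S : AddSubmonoid L} (hS : S.FG)
    (hsat : ∀ (k : ℕ) (m : L), 0 < k → k • m ∈ S → m ∈ S) {w : L}
    (hw : ∀ u : Module.Dual ℤ L, (∀ m ∈ S, 0 ≤ u m) → 0 ≤ u w) : w ∈ S := by
  obtain ⟨t, rfl⟩ := hS
  by_contra h
  obtain ⟨u, hu, huw⟩ := exists_dual_neg_of_nsmul_notMem_closure t id w fun k hk hkw =>
    h (hsat k w hk (by simpa using hkw))
  refine huw.not_ge (hw u fun m hm => ?_)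
  induction hm using AddSubmonoid.closure_induction with
  | mem x hx => exact hu x hx
  | zero => simp
  | add x y _ _ hx hy => rw [map_add]; exact add_nonneg hx hy

end Lattice

/-! ### Rational cones and saturated semigroups in the character lattice -/

namespace AffineToricVariety

variable {s : ℕ} (X : AffineToricVariety s)

theorem mem_coneSemigroup_iff (σ : PointedCone ℝ X.NReal) (m : X.M) :
    m ∈ X.coneSemigroup σ ↔ ∀ x ∈ σ, 0 ≤ X.toMReal m x := by
  simp only [coneSemigroup, dualCone, AddSubmonoid.mem_comap]
  exact Iff.rfl

theorem toMReal_nonneg_of_mem_hull {A : Set X.N} {m : X.M} (hm : ∀ u ∈ A, 0 ≤ u m)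
    {x : X.NReal} (hx : x ∈ PointedCone.hull ℝ ((fun u : X.N => (1 : ℝ) ⊗ₜ[ℤ] u) '' A)) :
    0 ≤ X.toMReal m x := by
  induction hx using Submodule.span_induction with
  | mem x hx =>
    obtain ⟨u, hu, rfl⟩ := hx
    simpa [toMReal_tmul] using hm u hu
  | zero => simp
  | add x y _ _ hx hy => rw [map_add]; exact add_nonneg hx hy
  | smul a x _ hx =>
    have : a • x = (a : ℝ) • x := rfl
    rw [this, map_smul, smul_eq_mul]
    exact mul_nonneg a.2 hx

theorem mem_coneSemigroup_hull (A : Set X.N) (m : X.M) :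
    m ∈ X.coneSemigroup (PointedCone.hull ℝ ((fun u : X.N => (1 : ℝ) ⊗ₜ[ℤ] u) '' A)) ↔
      ∀ u ∈ A, 0 ≤ u m := by
  rw [mem_coneSemigroup_iff]
  refine ⟨fun h u hu => ?_, fun h x hx => X.toMReal_nonneg_of_mem_hull h hx⟩
  have := h _ (Submodule.subset_span ⟨u, hu, rfl⟩)
  simpa [toMReal_tmul] using this

/-- Expand `x` in the basis of `N_ℝ` dual to a basis of `M`: its coordinates are values of
characters. -/
theorem eq_zero_of_forall_toMReal [Module.Free ℤ X.M] [Module.Finite ℤ X.M] {x : X.NReal}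
    (hx : ∀ m, X.toMReal m x = 0) : x = 0 := by
  let b := Module.Free.chooseBasis ℤ X.M
  have key : x = ∑ i, X.toMReal (b i) x • ((1 : ℝ) ⊗ₜ[ℤ] b.coord i) := by
    clear hx
    induction x using TensorProduct.induction_on with
    | zero => simp
    | add x y hx hy =>
      conv_lhs => rw [hx, hy]
      simp [add_smul, Finset.sum_add_distrib]
    | tmul a u =>
      have hu : u = ∑ i, u (b i) • b.coord i := by
        refine b.ext fun j => ?_
        simp
      conv_lhs => rw [hu, TensorProduct.tmul_sum]
      refine Finset.sum_congr rfl fun i _ => ?_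
      rw [toMReal_tmul, TensorProduct.smul_tmul', ← TensorProduct.smul_tmul]
      congr 1
      simp [mul_comm]
  rw [key]
  simp [hx]

theorem isSaturatedAffineSemigroup_coneSemigroup [Module.Free ℤ X.M] [Module.Finite ℤ X.M]
    {σ : PointedCone ℝ X.NReal} (hσ : X.IsRationalCone σ) :
    X.IsSaturatedAffineSemigroup (X.coneSemigroup σ) := by
  obtain ⟨A, rfl⟩ := hσ
  refine ⟨fg_of_forall_nonneg (fun u : A => (u : X.N).toAddMonoidHom) _ fun m => ?_,
    fun k m hk hm => ?_⟩
  · rw [mem_coneSemigroup_hull]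
    simp
  · rw [mem_coneSemigroup_hull] at hm ⊢
    intro u hu
    have := hm u hu
    rw [map_nsmul, nsmul_eq_mul] at this
    exact nonneg_of_mul_nonneg_right this (by exact_mod_cast hk)

/-- A saturated affine semigroup generating `M` is the semigroup of a strongly convex rational
cone. -/
theorem exists_coneSemigroup_eq [Module.Free ℤ X.M] [Module.Finite ℤ X.M]
    {S : AddSubmonoid X.M} (hS : X.IsSaturatedAffineSemigroup S)
    (hgen : ∀ m, ∃ a ∈ S, a + m ∈ S) :
    ∃ σ : PointedCone ℝ X.NReal, X.IsRationalCone σ ∧ X.IsStronglyConvex σ ∧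
      X.coneSemigroup σ = S := by
  obtain ⟨t, ht⟩ := hS.1
  -- The dual monoid of `S`. Gordan's lemma makes it finitely generated, and its generators span the
  -- cone.
  let P : AddSubmonoid X.N :=
    { carrier := {u | ∀ m ∈ S, 0 ≤ u m}
      zero_mem' := by simp
      add_mem' := fun {u u'} hu hu' m hm => add_nonneg (hu m hm) (hu' m hm) }
  have hP : P.FG := by
    refine fg_of_forall_nonneg (fun m : t => (Module.Dual.eval ℤ X.M m.1).toAddMonoidHom) _
      fun u => ⟨fun hu m => hu m (ht ▸ AddSubmonoid.subset_closure m.2), fun hu m hm => ?_⟩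
    rw [← ht] at hm
    induction hm using AddSubmonoid.closure_induction with
    | mem x hx => exact hu ⟨x, hx⟩
    | zero => simp
    | add x y _ _ hx hy => rw [map_add]; exact add_nonneg hx hy
  obtain ⟨A, hA⟩ := hP
  have hAP (u) (hu : u ∈ A) : u ∈ P := hA ▸ AddSubmonoid.subset_closure hu
  refine ⟨_, ⟨A, rfl⟩, ?_, ?_⟩
  · ext x
    simp only [Set.mem_ofPred_eq, Set.mem_singleton_iff]
    refine ⟨fun ⟨hx, hx'⟩ => ?_, ?_⟩
    · have h0 (m) (hm : m ∈ S) : X.toMReal m x = 0 := by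
        refine le_antisymm ?_ (X.toMReal_nonneg_of_mem_hull (fun u hu => hAP u hu m hm) hx)
        have := X.toMReal_nonneg_of_mem_hull (fun u hu => hAP u hu m hm) hx'
        simpa using this
      refine X.eq_zero_of_forall_toMReal fun m => ?_
      obtain ⟨a, ha, ham⟩ := hgen m
      have := h0 _ ham
      rwa [map_add, LinearMap.add_apply, h0 a ha, zero_add] at this
    · rintro rfl
      simp
  · ext m
    rw [mem_coneSemigroup_hull]
    refine ⟨fun hm => mem_of_forall_dual_nonneg hS.1 hS.2 fun u hu => ?_,
      fun hm u hu => hAP u hu m hm⟩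
    have hu' : u ∈ AddSubmonoid.closure (A : Set X.N) := hA ▸ hu
    clear hu
    induction hu' using AddSubmonoid.closure_induction with
    | mem x hx => exact hm x hx
    | zero => simp
    | add x y _ _ hx hy => exact add_nonneg hx hy

end AffineToricVariety

/-! ### Laurent polynomial rings are integrally closed -/

theorem isIntegrallyClosed_laurentPolynomial {R : Type*} [CommRing R] [IsDomain R]
    [IsIntegrallyClosed R] : IsIntegrallyClosed (LaurentPolynomial R) :=
  isIntegrallyClosed_of_isLocalization _ (Submonoid.powers (Polynomial.X : Polynomial R))
    (powers_le_nonZeroDivisors_of_noZeroDivisors Polynomial.X_ne_zero)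

/-- Induction through `R[ℤ^(n+1)] ≃ (R[ℤ^n])[ℤ]`, Laurent polynomials in one variable over a normal
domain. -/
theorem isIntegrallyClosed_addMonoidAlgebra_pi {R : Type*} [CommRing R] [IsDomain R]
    [IsIntegrallyClosed R] (n : ℕ) : IsIntegrallyClosed (AddMonoidAlgebra R (Fin n → ℤ)) := by
  induction n with
  | zero => exact .of_equiv (AddMonoidAlgebra.uniqueRingEquiv (R := R) (Fin 0 → ℤ)).symm
  | succ n ih =>
    let e : (ℤ × (Fin n → ℤ)) ≃+ (Fin (n + 1) → ℤ) :=
      { Fin.consEquiv fun _ => ℤ with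
        map_add' := fun a b => by
          ext i
          refine Fin.cases ?_ (fun j => ?_) i <;> simp [Fin.consEquiv] }
    have h : IsIntegrallyClosed (AddMonoidAlgebra (AddMonoidAlgebra R (Fin n → ℤ)) ℤ) :=
      isIntegrallyClosed_laurentPolynomial
    let e₁ : AddMonoidAlgebra R (ℤ × (Fin n → ℤ)) ≃+*
      AddMonoidAlgebra (AddMonoidAlgebra R (Fin n → ℤ)) ℤ := AddMonoidAlgebra.curryRingEquiv
    let e₂ : AddMonoidAlgebra R (ℤ × (Fin n → ℤ)) ≃+* AddMonoidAlgebra R (Fin (n + 1) → ℤ) :=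
      AddMonoidAlgebra.mapDomainRingEquiv R e
    have h' : IsIntegrallyClosed (AddMonoidAlgebra R (ℤ × (Fin n → ℤ))) := .of_equiv e₁.symm
    exact .of_equiv e₂

namespace AffineToricVariety

variable {s : ℕ} (X : AffineToricVariety s)

/-! ### Characters as functions on the torus -/

/-- The character `χ^m` as a function on the torus. -/
def charFun (m : X.M) : X.T → ℂ := fun t => X.char m t

theorem charFun_add (m m' : X.M) : X.charFun (m + m') = X.charFun m * X.charFun m' := by
  ext t
  simp [charFun, char]

theorem charFun_zero : X.charFun 0 = 1 := by
  ext t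
  simp [charFun, char]

theorem charFun_nsmul (k : ℕ) (m : X.M) : X.charFun (k • m) = X.charFun m ^ k := by
  ext t
  simp [charFun, char]

theorem charFun_mul_apply (m : X.M) (t t' : X.T) :
    X.charFun m (t * t') = X.charFun m t * X.charFun m t' := by
  simp [charFun]

theorem isRegularFun_charFun (m : X.M) : IsRegularFun (coords X.T) (X.charFun m) :=
  (Additive.toMul m).2

/-- Dedekind's independence of characters, the source of all comparisons of coefficients below. -/
theorem linearIndependent_charFun : LinearIndependent ℂ X.charFun := by
  refine (linearIndependent_monoidHom X.T ℂ).comp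
    (fun m => (Units.coeHom ℂ).comp (X.char m)) fun m m' h => ?_
  refine Additive.toMul.injective (Subtype.ext (MonoidHom.ext fun t => Units.ext ?_))
  exact DFunLike.congr_fun h t

/-- The semigroup algebra as an algebra of functions on the torus. -/
def charHom (S : AddSubmonoid X.M) : AddMonoidAlgebra ℂ S →ₐ[ℂ] (X.T → ℂ) :=
  AddMonoidAlgebra.lift ℂ _ S
    { toFun m := X.charFun (m.toAdd : X.M)
      map_one' := X.charFun_zero
      map_mul' _ _ := X.charFun_add _ _ }

theorem charHom_single (S : AddSubmonoid X.M) (m : S) (a : ℂ) :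
    X.charHom S (AddMonoidAlgebra.single m a) = a • X.charFun m := by
  simp [charHom]

theorem charHom_apply (S : AddSubmonoid X.M) (x : AddMonoidAlgebra ℂ S) :
    X.charHom S x = Finsupp.linearCombination ℂ (fun m : S => X.charFun m) x.coeff := by
  simp [charHom, AddMonoidAlgebra.lift_apply, Finsupp.linearCombination_apply]

theorem charHom_injective (S : AddSubmonoid X.M) : Function.Injective (X.charHom S) := by
  refine (injective_iff_map_eq_zero _).2 fun x hx => ?_
  rw [charHom_apply] at hx
  have := linearIndependent_iff.1
    (X.linearIndependent_charFun.comp ((↑) : S → X.M) Subtype.val_injective) _ hx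
  exact AddMonoidAlgebra.coeff_injective this

theorem mem_range_charHom {S : AddSubmonoid X.M} {f : X.T → ℂ} :
    f ∈ (X.charHom S).range ↔ f ∈ Submodule.span ℂ (X.charFun '' S) := by
  rw [Set.image_eq_range, Finsupp.mem_span_range_iff_exists_finsupp]
  constructor
  · rintro ⟨x, rfl⟩
    exact ⟨x.coeff, (X.charHom_apply S x).symm⟩
  · rintro ⟨l, rfl⟩
    exact ⟨AddMonoidAlgebra.ofCoeff l, X.charHom_apply S _⟩

/-- Translation of functions by an element of the torus. -/
def translate (t : X.T) : (X.T → ℂ) →ₐ[ℂ] (X.T → ℂ) :=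
  AlgHom.pi fun t' => Pi.evalAlgHom ℂ (fun _ => ℂ) (t * t')

theorem translate_apply (t t' : X.T) (f : X.T → ℂ) : X.translate t f t' = f (t * t') := rfl

theorem translate_charFun (t : X.T) (m : X.M) :
    X.translate t (X.charFun m) = X.charFun m t • X.charFun m := by
  ext t'
  simp [translate_apply, charFun_mul_apply]

/-- The characters occurring in an element of a translation invariant subspace belong to the
subspace. -/
theorem charFun_mem_of_linearCombination_mem {A : Submodule ℂ (X.T → ℂ)}
    (hA : ∀ t, ∀ f ∈ A, X.translate t f ∈ A) {l : X.M →₀ ℂ}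
    (hl : Finsupp.linearCombination ℂ X.charFun l ∈ A) {m : X.M} (hm : m ∈ l.support) :
    X.charFun m ∈ A := by
  by_contra hmA
  obtain ⟨ℓ, hℓ, hℓA⟩ := Submodule.exists_le_ker_of_notMem hmA
  -- Translation by `t` multiplies each `χ^i` by `χ^i(t)`. Applying `ℓ` to all translates therefore
  -- gives a linear relation between characters.
  have h0 : ∑ i ∈ l.support, (l i * ℓ (X.charFun i)) • X.charFun i = 0 := by
    ext t
    have h := hℓA (hA t _ hl)
    rw [LinearMap.mem_ker, Finsupp.linearCombination_apply, Finsupp.sum, map_sum, map_sum] at h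
    rw [Pi.zero_apply, ← h, Finset.sum_apply]
    refine Finset.sum_congr rfl fun i _ => ?_
    rw [map_smul, translate_charFun, map_smul, map_smul]
    simp only [Pi.smul_apply, smul_eq_mul]
    ring
  have := linearIndependent_iff'.1 X.linearIndependent_charFun _ _ h0 m hm
  exact mul_ne_zero (Finsupp.mem_support_iff.1 hm) hℓ this

/-! ### Normality of saturated semigroup algebras -/

theorem translate_mem_range_charHom {S : AddSubmonoid X.M} (t : X.T) {f : X.T → ℂ}
    (hf : f ∈ (X.charHom S).range) : X.translate t f ∈ (X.charHom S).range := by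
  rw [mem_range_charHom] at hf ⊢
  induction hf using Submodule.span_induction with
  | mem f hf =>
    obtain ⟨m, hm, rfl⟩ := hf
    rw [translate_charFun]
    exact Submodule.smul_mem _ _ (Submodule.subset_span ⟨m, hm, rfl⟩)
  | zero => simp
  | add f g _ _ hf hg => rw [map_add]; exact add_mem hf hg
  | smul a f _ hf => rw [map_smul]; exact Submodule.smul_mem _ _ hf

/-- Translation is a ring endomorphism mapping the coefficient ring to itself, so it preserves
integral equations. -/
theorem isIntegral_translate {S : AddSubmonoid X.M} (t : X.T) {f : X.T → ℂ}
    (hf : IsIntegral (X.charHom S).range f) : IsIntegral (X.charHom S).range (X.translate t f) :=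
  hf.map_of_comp_eq
    ((X.translate t : (X.T → ℂ) →+* (X.T → ℂ)).restrict (X.charHom S).range (X.charHom S).range
      fun _ hf => X.translate_mem_range_charHom t hf)
    (X.translate t : (X.T → ℂ) →+* (X.T → ℂ)) (by ext; rfl)

/-- In an integral equation of degree `d`, the character `χ^(dm)` must cancel against some `χ^(b +
im)` with `i < d` and `b ∈ S`, so `(d - i) m = b`. -/
theorem exists_nsmul_mem_of_isIntegral_charFun {S : AddSubmonoid X.M} {m : X.M}
    (hm : IsIntegral (X.charHom S).range (X.charFun m)) : ∃ k : ℕ, 0 < k ∧ k • m ∈ S := by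
  obtain ⟨p, hp, hpm⟩ := hm
  by_contra! hk
  have hmem : X.charFun (p.natDegree • m) ∈
      Submodule.span ℂ (X.charFun '' {a | ∃ i < p.natDegree, ∃ b ∈ S, a = b + i • m}) := by
    rw [Polynomial.eval₂_eq_sum_range, Finset.sum_range_succ, hp.coeff_natDegree, map_one, one_mul,
      ← charFun_nsmul, add_comm] at hpm
    rw [eq_neg_of_add_eq_zero_left hpm]
    refine neg_mem (sum_mem fun i hi => ?_)
    rw [← charFun_nsmul]
    have h := X.mem_range_charHom.1 (p.coeff i).2
    change (p.coeff i : X.T → ℂ) * _ ∈ _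
    generalize (p.coeff i : X.T → ℂ) = c at h ⊢
    induction h using Submodule.span_induction with
    | mem f hf =>
      obtain ⟨b, hb, rfl⟩ := hf
      rw [← charFun_add]
      exact Submodule.subset_span ⟨_, ⟨i, Finset.mem_range.1 hi, b, hb, rfl⟩, rfl⟩
    | zero => simp
    | add f g _ _ hf hg => rw [add_mul]; exact add_mem hf hg
    | smul a f _ hf => rw [smul_mul_assoc]; exact Submodule.smul_mem _ _ hf
  refine X.linearIndependent_charFun.notMem_span_image ?_ hmem
  rintro ⟨i, hi, b, hb, h⟩
  refine hk (p.natDegree - i) (by omega) ?_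
  have : (p.natDegree - i) • m + i • m = b + i • m := by
    rw [← add_smul, Nat.sub_add_cancel hi.le, h]
  rwa [add_right_cancel this]

/-- Since `ℂ[M]` is normal, only elements of `ℂ[M]` integral over `ℂ[S]` matter. The integral
closure is translation invariant, so the characters in such an element are integral too, and
saturation puts them in `S`. -/
theorem isIntegrallyClosed_addMonoidAlgebra {S : AddSubmonoid X.M} {n : ℕ}
    (Ψ : (Fin n → ℤ) ≃+ X.M) (hS : ∀ (k : ℕ) (m : X.M), 0 < k → k • m ∈ S → m ∈ S) :
    IsIntegrallyClosed (AddMonoidAlgebra ℂ S) := by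
  let e : AddMonoidAlgebra ℂ (Fin n → ℤ) ≃+* AddMonoidAlgebra ℂ (⊤ : AddSubmonoid X.M) :=
    AddMonoidAlgebra.mapDomainRingEquiv ℂ (Ψ.trans AddSubmonoid.topEquiv.symm)
  have := isIntegrallyClosed_addMonoidAlgebra_pi (R := ℂ) n
  have : IsDomain (AddMonoidAlgebra ℂ (⊤ : AddSubmonoid X.M)) := e.symm.toMulEquiv.isDomain _
  have : IsIntegrallyClosed (AddMonoidAlgebra ℂ (⊤ : AddSubmonoid X.M)) := .of_equiv e
  let j : AddMonoidAlgebra ℂ S →ₐ[ℂ] AddMonoidAlgebra ℂ (⊤ : AddSubmonoid X.M) :=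
    AddMonoidAlgebra.mapDomainAlgHom ℂ ℂ (AddSubmonoid.inclusion le_top)
  have hj : (X.charHom ⊤).comp j = X.charHom S := by
    refine AddMonoidAlgebra.algHom_ext (fun m => ?_) (by ext)
    simp [j, charHom_single]
  have hj' (x) : X.charHom ⊤ (j x) = X.charHom S x := DFunLike.congr_fun hj x
  algebraize [j.toRingHom]
  have hinj : Function.Injective j := fun x y hxy =>
    X.charHom_injective S (by rw [← hj', ← hj', hxy])
  have : FaithfulSMul (AddMonoidAlgebra ℂ S) (AddMonoidAlgebra ℂ (⊤ : AddSubmonoid X.M)) :=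
    (faithfulSMul_iff_algebraMap_injective _ _).2 hinj
  have : IsIntegrallyClosedIn (AddMonoidAlgebra ℂ S)
      (AddMonoidAlgebra ℂ (⊤ : AddSubmonoid X.M)) := by
    refine isIntegrallyClosedIn_iff.2 ⟨hinj, fun {x} hx => ?_⟩
    have hx' : IsIntegral (X.charHom S).range (X.charHom ⊤ x) :=
      hx.map_of_comp_eq ((X.charHom S).rangeRestrict : _ →+* (X.charHom S).range)
        (X.charHom ⊤ : _ →+* (X.T → ℂ)) (RingHom.ext fun y => (hj' y).symm)
    let A : Submodule ℂ (X.T → ℂ) :=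
      (Subalgebra.toSubmodule (integralClosure (X.charHom S).range (X.T → ℂ))).restrictScalars ℂ
    obtain ⟨l, hl⟩ : ∃ l, Finsupp.linearCombination ℂ X.charFun l = X.charHom ⊤ x := by
      have := X.mem_range_charHom.1 ⟨x, rfl⟩
      exact Finsupp.mem_span_range_iff_exists_finsupp.1
        (Submodule.span_mono (Set.image_subset_range _ _) this)
    have hlA : Finsupp.linearCombination ℂ X.charFun l ∈ A := hl ▸ hx'
    have hxS : X.charHom ⊤ x ∈ (X.charHom S).range := by
      rw [mem_range_charHom, ← hl, Finsupp.linearCombination_apply]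
      refine sum_mem fun m hm => Submodule.smul_mem _ _ (Submodule.subset_span ⟨m, ?_, rfl⟩)
      obtain ⟨k, hk, hkm⟩ := X.exists_nsmul_mem_of_isIntegral_charFun
        (X.charFun_mem_of_linearCombination_mem (A := A)
          (fun t f hf => X.isIntegral_translate t hf) hlA hm)
      exact hS k m hk hkm
    obtain ⟨y, hy⟩ := hxS
    exact ⟨y, X.charHom_injective ⊤ ((hj' y).trans hy)⟩
  exact .of_isIntegrallyClosed_of_isIntegrallyClosedIn _
    (AddMonoidAlgebra ℂ (⊤ : AddSubmonoid X.M))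

end AffineToricVariety

/-! ### Regular functions on the standard torus -/

section Torus

variable {n : ℕ}

/-- The Laurent monomial with exponent `a`, a character of `(ℂ^*)^n`. -/
def laurentMonomial (a : Fin n → ℤ) : (Fin n → ℂˣ) →* ℂˣ where
  toFun t := ∏ i, t i ^ a i
  map_one' := by simp
  map_mul' t t' := by simp [mul_zpow, Finset.prod_mul_distrib]

theorem laurentMonomial_apply (a : Fin n → ℤ) (t : Fin n → ℂˣ) :
    laurentMonomial a t = ∏ i, t i ^ a i := rfl

theorem isRegularFun_laurentMonomial (a : Fin n → ℤ) :
    IsRegularFun (torusCoords n) (fun t => (laurentMonomial a t : ℂ)) := by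
  refine fun _ => ⟨∏ i, X i ^ (a i).toNat, ∏ i, X i ^ (-a i).toNat, ?_, fun t _ => ?_⟩
  · simp [torusCoords, Finset.prod_ne_zero_iff]
  · simp only [laurentMonomial_apply, Units.coe_prod, Units.val_zpow_eq_zpow_val, map_prod, map_pow,
      eval_X, torusCoords, ← Finset.prod_div_distrib]
    refine Finset.prod_congr rfl fun i _ => ?_
    rw [← zpow_natCast, ← zpow_natCast, ← zpow_sub₀ (t i).ne_zero]
    congr 1
    omega

/-- The torus is the complement of `∏ X i = 0` in affine space, so a power of this product clears
the denominators of `f`. -/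
theorem IsRegularFun.mem_span_laurentMonomial {f : (Fin n → ℂˣ) → ℂ}
    (hf : IsRegularFun (torusCoords n) f) :
    f ∈ Submodule.span ℂ (Set.range fun a t => (laurentMonomial a t : ℂ)) := by
  obtain ⟨k, p, hp⟩ := hf.exists_pow_mul_eq_eval (∏ i, X i) fun y _ hy => by
    have hy' (i) : y i ≠ 0 := by
      simp only [map_prod, eval_X, Finset.prod_ne_zero_iff] at hy
      exact hy i (Finset.mem_univ i)
    exact ⟨fun i => Units.mk0 (y i) (hy' i), rfl⟩
  have : f = ∑ d ∈ p.support, p.coeff d • fun t => (laurentMonomial (fun i => d i - k) t : ℂ) := by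
    ext t
    have h := hp t
    have h0 : (∏ i, (t i : ℂ)) ^ k ≠ 0 := pow_ne_zero _ (by simp [Finset.prod_ne_zero_iff])
    simp only [map_prod, eval_X, torusCoords] at h
    rw [eval_eq', mul_comm, ← eq_div_iff h0] at h
    rw [h, Finset.sum_div, Finset.sum_apply]
    refine Finset.sum_congr rfl fun d _ => ?_
    rw [Pi.smul_apply, smul_eq_mul, mul_div_assoc, ← Finset.prod_pow, ← Finset.prod_div_distrib]
    simp only [laurentMonomial_apply, Units.coe_prod, Units.val_zpow_eq_zpow_val]
    congr 1
    refine Finset.prod_congr rfl fun i _ => ?_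
    rw [zpow_sub₀ (t i).ne_zero, zpow_natCast, zpow_natCast, torusCoords]
  rw [this]
  exact sum_mem fun d _ => Submodule.smul_mem _ _ (Submodule.subset_span ⟨_, rfl⟩)

/-- Evaluation at the point with `2` in place `i` and `1` elsewhere recovers the exponent, since `2`
has infinite order. -/
theorem laurentMonomial_injective : Function.Injective (laurentMonomial (n := n)) := by
  intro a b h
  ext i
  have := DFunLike.congr_fun h (Pi.mulSingle i (Units.mk0 (2 : ℂ) two_ne_zero))
  have key (a : Fin n → ℤ) : (laurentMonomial a (Pi.mulSingle i (Units.mk0 (2 : ℂ) two_ne_zero)) :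
      ℂ) = ((2 : ℝ) ^ a i : ℝ) := by
    rw [laurentMonomial_apply, Finset.prod_eq_single i]
    · simp
    · intro j _ hj
      simp [Pi.mulSingle_eq_of_ne hj]
    · simp
  have h2 : ((2 : ℝ) ^ a i : ℝ) = (2 : ℝ) ^ b i := by
    have h3 := congrArg (Units.val : ℂˣ → ℂ) this
    rw [key, key] at h3
    exact_mod_cast h3
  exact zpow_right_injective₀ two_pos (by norm_num) h2

end Torus

/-! ### The character lattice of the torus -/

namespace AffineToricVariety

variable {s : ℕ} (X : AffineToricVariety s)

theorem exists_laurentHom : ∃ (n : ℕ) (Ψ : (Fin n → ℤ) →+ X.M), Function.Injective Ψ ∧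
    ∀ f : X.T → ℂ, IsRegularFun (coords X.T) f →
      f ∈ Submodule.span ℂ (Set.range fun a => X.charFun (Ψ a)) := by
  obtain ⟨n, φ, hφ, hφ'⟩ := X.torus
  let Ψ : (Fin n → ℤ) →+ X.M :=
    { toFun a := Additive.ofMul ⟨(laurentMonomial a).comp φ.symm.toMonoidHom,
        (isRegularFun_laurentMonomial a).comp hφ'⟩
      map_zero' := by
        refine Additive.toMul.injective (Subtype.ext (MonoidHom.ext fun t => ?_))
        simp [laurentMonomial_apply]
      map_add' a b := by
        refine Additive.toMul.injective (Subtype.ext (MonoidHom.ext fun t => ?_))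
        simp [laurentMonomial_apply, zpow_add, Finset.prod_mul_distrib] }
  have hΨ (a t) : X.char (Ψ a) t = laurentMonomial a (φ.symm t) := rfl
  refine ⟨n, Ψ, fun a b hab => laurentMonomial_injective (MonoidHom.ext fun t => ?_),
    fun f hf => ?_⟩
  · have := hΨ a (φ t)
    rw [hab, hΨ b] at this
    simpa using this.symm
  · obtain ⟨l, hl⟩ := Finsupp.mem_span_range_iff_exists_finsupp.1
      (hf.comp hφ).mem_span_laurentMonomial
    refine Finsupp.mem_span_range_iff_exists_finsupp.2 ⟨l, ?_⟩
    ext t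
    have := congrFun hl (φ.symm t)
    simp only [MulEquiv.apply_symm_apply] at this
    rw [← this]
    simp only [Finsupp.sum, Finset.sum_apply, Pi.smul_apply]
    rfl

/-- The character lattice of a torus is a lattice. -/
theorem exists_latticeEquiv : ∃ n : ℕ, Nonempty ((Fin n → ℤ) ≃+ X.M) := by
  obtain ⟨n, Ψ, hΨ, hspan⟩ := X.exists_laurentHom
  refine ⟨n, ⟨AddEquiv.ofBijective Ψ ⟨hΨ, fun m => ?_⟩⟩⟩
  -- A character outside the image of `Ψ` is independent of those in the image, yet, being regular,
  -- it lies in their span.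
  by_contra hm
  refine X.linearIndependent_charFun.notMem_span_image (s := Set.range Ψ) hm ?_
  rw [← Set.range_comp]
  exact hspan _ (X.isRegularFun_charFun m)

theorem isDomain_addMonoidAlgebra (S : AddSubmonoid X.M) : IsDomain (AddMonoidAlgebra ℂ S) := by
  obtain ⟨n, ⟨Ψ⟩⟩ := X.exists_latticeEquiv
  let j : AddMonoidAlgebra ℂ S →+* AddMonoidAlgebra ℂ (Fin n → ℤ) :=
    AddMonoidAlgebra.mapDomainRingHom ℂ (Ψ.symm.toAddMonoidHom.comp S.subtype)
  have hj : Function.Injective j :=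
    AddMonoidAlgebra.mapDomain_injective (Ψ.symm.injective.comp Subtype.val_injective)
  exact hj.isDomain j

instance : Module.Free ℤ X.M :=
  let ⟨_, ⟨Ψ⟩⟩ := X.exists_latticeEquiv
  .of_equiv Ψ.toIntLinearEquiv

instance : Module.Finite ℤ X.M :=
  let ⟨_, ⟨Ψ⟩⟩ := X.exists_latticeEquiv
  .equiv Ψ.toIntLinearEquiv

theorem mem_span_charFun_of_isRegularFun {f : X.T → ℂ} (hf : IsRegularFun (coords X.T) f) :
    f ∈ Submodule.span ℂ (Set.range X.charFun) := by
  obtain ⟨n, Ψ, -, hspan⟩ := X.exists_laurentHom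
  exact Submodule.span_mono (by rintro _ ⟨a, rfl⟩; exact ⟨_, rfl⟩) (hspan f hf)

/-- Functions on `T` have zero divisors, but the regular ones form the image of the domain `ℂ[M]`.
-/
theorem mul_left_cancel_of_isRegularFun {q f g : X.T → ℂ} (hq : IsRegularFun (coords X.T) q)
    (hf : IsRegularFun (coords X.T) f) (hg : IsRegularFun (coords X.T) g) (hq0 : q ≠ 0)
    (h : q * f = q * g) : f = g := by
  have := X.isDomain_addMonoidAlgebra ⊤
  have hrange {f} (hf : IsRegularFun (coords X.T) f) : f ∈ (X.charHom ⊤).range := by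
    rw [mem_range_charHom, AddSubmonoid.coe_top, Set.image_univ]
    exact X.mem_span_charFun_of_isRegularFun hf
  obtain ⟨x, rfl⟩ := hrange hq
  obtain ⟨y, rfl⟩ := hrange hf
  obtain ⟨z, rfl⟩ := hrange hg
  have hx : x ≠ 0 := by
    rintro rfl
    exact hq0 (map_zero _)
  have hxyz : x * y = x * z := X.charHom_injective ⊤ (by rw [map_mul, map_mul]; exact h)
  rw [mul_left_cancel₀ hx hxyz]

/-! ### The coordinate ring of an affine toric variety -/

/-- Restriction of regular functions from `V` to the torus. -/
def restrictTorus : CoordRing X.V →ₐ[ℂ] (X.T → ℂ) :=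
  AlgHom.pi fun t => evalAt ⟨t.1, X.subset t.2⟩

theorem restrictTorus_apply (r : CoordRing X.V) (t : X.T) :
    X.restrictTorus r t = evalAt ⟨t.1, X.subset t.2⟩ r := rfl

theorem restrictTorus_mk (p : MvPolynomial (Fin s) ℂ) (t : X.T) :
    X.restrictTorus (Ideal.Quotient.mk _ p) t = eval t.1 p := by
  rw [restrictTorus_apply, evalAt_mk]

theorem restrictTorus_injective : Function.Injective X.restrictTorus := by
  refine (injective_iff_map_eq_zero _).2 fun r hr => ?_
  obtain ⟨p, rfl⟩ := Ideal.Quotient.mk_surjective r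
  refine Ideal.Quotient.eq_zero_iff_mem.2 fun x hx => ?_
  have h := X.dense {x | ∀ f ∈ ({p} : Finset (MvPolynomial (Fin s) ℂ)), eval x f = 0}
    ⟨{p}, rfl⟩ fun t ht => by
      have := congrFun hr ⟨t, ht⟩
      rw [restrictTorus_mk] at this
      simpa using this
  simpa [aeval_eq_eval] using h hx

theorem isRegularFun_of_mem_range_restrictTorus {f : X.T → ℂ} (hf : f ∈ X.restrictTorus.range) :
    IsRegularFun (coords X.T) f := by
  obtain ⟨r, rfl⟩ := hf
  obtain ⟨p, rfl⟩ := Ideal.Quotient.mk_surjective r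
  convert isRegularFun_eval (coords X.T) p using 1
  ext t
  exact X.restrictTorus_mk p t

/-- The functions on `T` that extend to `V` are stable under translation. -/
theorem translate_mem_range_restrictTorus (t : X.T) {f : X.T → ℂ}
    (hf : f ∈ X.restrictTorus.range) : X.translate t f ∈ X.restrictTorus.range := by
  obtain ⟨r, rfl⟩ := hf
  obtain ⟨p, rfl⟩ := Ideal.Quotient.mk_surjective r
  obtain ⟨act, hact, -, -, hmul⟩ := X.action
  have hinc : IsRegularMap (coords X.V) (prodCoords (coords X.T) (coords X.V))
      (fun x => (t, x)) := by
    rintro (j | j)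
    · exact fun _ => ⟨C (t.1 j), 1, by simp, fun y _ => by simp [prodCoords, coords]⟩
    · exact fun _ => ⟨MvPolynomial.X j, 1, by simp, fun y _ => by simp [prodCoords]⟩
  -- Acting by a fixed `t` is a morphism `V → V`, hence given by polynomials `P j`; translating `p`
  -- means substituting them.
  choose P hP using fun j => ((hact j).comp hinc).exists_eq_eval X.isAffineVariety
  refine ⟨Ideal.Quotient.mk _ (bind₁ P p), ?_⟩
  ext t'
  change X.restrictTorus (Ideal.Quotient.mk _ _) t' = _
  rw [translate_apply]
  change _ = X.restrictTorus (Ideal.Quotient.mk _ p) (t * t')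
  rw [restrictTorus_mk, restrictTorus_mk]
  have h : (t * t').1 = fun j => eval t'.1 (P j) := by
    ext j
    rw [← hP j ⟨t'.1, X.subset t'.2⟩, hmul]
    rfl
  rw [h, ← aeval_eq_eval, ← aeval_eq_eval, aeval_bind₁]

/-- The semigroup of the characters that extend to regular functions on `V`. -/
def extendingSemigroup : AddSubmonoid X.M where
  carrier := {m | X.charFun m ∈ X.restrictTorus.range}
  zero_mem' := by
    rw [Set.mem_ofPred_eq, charFun_zero]
    exact one_mem _
  add_mem' {m m'} hm hm' := by
    rw [Set.mem_ofPred_eq, charFun_add]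
    exact mul_mem hm hm'

theorem mem_span_extendingSemigroup {f : X.T → ℂ} (hf : f ∈ X.restrictTorus.range) :
    ∃ l : X.M →₀ ℂ, (∀ m ∈ l.support, m ∈ X.extendingSemigroup) ∧
      Finsupp.linearCombination ℂ X.charFun l = f := by
  obtain ⟨l, rfl⟩ := Finsupp.mem_span_range_iff_exists_finsupp.1
    (X.mem_span_charFun_of_isRegularFun (X.isRegularFun_of_mem_range_restrictTorus hf))
  exact ⟨l, fun m hm => X.charFun_mem_of_linearCombination_mem
    (A := Subalgebra.toSubmodule X.restrictTorus.range)
    (fun t f hf => X.translate_mem_range_restrictTorus t hf) hf hm, rfl⟩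

theorem range_charHom_extendingSemigroup :
    (X.charHom X.extendingSemigroup).range = X.restrictTorus.range := by
  apply le_antisymm
  · intro f hf
    rw [mem_range_charHom] at hf
    refine (Submodule.span_le (p := Subalgebra.toSubmodule X.restrictTorus.range)).2 ?_ hf
    rintro _ ⟨m, hm, rfl⟩
    exact hm
  · intro f hf
    rw [mem_range_charHom]
    obtain ⟨l, hl, rfl⟩ := X.mem_span_extendingSemigroup hf
    rw [Finsupp.linearCombination_apply]
    exact sum_mem fun m hm =>
      Submodule.smul_mem _ _ (Submodule.subset_span ⟨m, hl m hm, rfl⟩)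

/-- The coordinate ring of an affine toric variety is a semigroup algebra. -/
def semigroupAlgebraEquiv : AddMonoidAlgebra ℂ X.extendingSemigroup ≃ₐ[ℂ] CoordRing X.V :=
  (AlgEquiv.ofInjective _ (X.charHom_injective _)).trans
    ((Subalgebra.equivOfEq _ _ X.range_charHom_extendingSemigroup).trans
      (AlgEquiv.ofInjective _ X.restrictTorus_injective).symm)

theorem restrictTorus_semigroupAlgebraEquiv (x : AddMonoidAlgebra ℂ X.extendingSemigroup) :
    X.restrictTorus (X.semigroupAlgebraEquiv x) = X.charHom _ x := by
  have h := (AlgEquiv.ofInjective _ X.restrictTorus_injective).apply_symm_apply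
    (Subalgebra.equivOfEq _ _ X.range_charHom_extendingSemigroup
      (AlgEquiv.ofInjective _ (X.charHom_injective _) x))
  exact congrArg Subtype.val h

theorem eqSpecm_extendingSemigroup : X.EqSpecm X.extendingSemigroup := by
  refine ⟨SpecmIso.ofAlgEquiv X.isAffineVariety X.semigroupAlgebraEquiv, fun m t => ?_⟩
  have := congrFun (X.restrictTorus_semigroupAlgebraEquiv (AddMonoidAlgebra.single m 1)) t
  rw [charHom_single, one_smul] at this
  exact this

theorem fg_extendingSemigroup : X.extendingSemigroup.FG := by
  have : Algebra.FiniteType ℂ (AddMonoidAlgebra ℂ X.extendingSemigroup) :=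
    .equiv inferInstance X.semigroupAlgebraEquiv.symm
  exact (AddMonoid.fg_iff_addSubmonoid_fg _).1 (AddMonoidAlgebra.finiteType_iff_fg.1 this)

/-- Every character is a quotient of regular functions on `V`. -/
theorem exists_mul_charFun_mem_range (m : X.M) : ∃ q ∈ X.restrictTorus.range, q ≠ 0 ∧
    q * X.charFun m ∈ X.restrictTorus.range := by
  obtain ⟨p, q, hq, h⟩ := X.isRegularFun_charFun m 1
  -- The local expression `p / q` of `χ^m` near the identity becomes a global identity after
  -- multiplication by `q²`.
  refine ⟨X.restrictTorus (Ideal.Quotient.mk _ (q * q)), ⟨_, rfl⟩, fun h0 => ?_,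
    Ideal.Quotient.mk _ (q * p), ?_⟩
  · have := congrFun h0 1
    rw [restrictTorus_mk, map_mul] at this
    exact mul_ne_zero hq hq this
  · ext t
    change X.restrictTorus _ t = X.restrictTorus _ t * _
    rw [restrictTorus_mk, restrictTorus_mk, map_mul, map_mul]
    by_cases ht : eval t.1 q = 0
    · simp [ht]
    · rw [h t ht]
      simp only [coords]
      field_simp

/-- If `q` and `q χ^m` both extend to `V`, then for any character `χ^a` occurring in `q`, `χ^(a+m)`
occurs in `q χ^m`, and both extend. -/
theorem exists_add_mem_extendingSemigroup (m : X.M) :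
    ∃ a ∈ X.extendingSemigroup, a + m ∈ X.extendingSemigroup := by
  obtain ⟨q, hq, hq0, hqm⟩ := X.exists_mul_charFun_mem_range m
  obtain ⟨l, hl, rfl⟩ := X.mem_span_extendingSemigroup hq
  obtain ⟨a, ha⟩ : l.support.Nonempty := by
    rw [Finsupp.support_nonempty_iff]
    rintro rfl
    simp at hq0
  refine ⟨a, hl a ha, ?_⟩
  have e : Finsupp.linearCombination ℂ X.charFun l * X.charFun m =
      Finsupp.linearCombination ℂ X.charFun (l.mapDomain (· + m)) := by
    rw [Finsupp.linearCombination_mapDomain, Finsupp.linearCombination_apply,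
      Finsupp.linearCombination_apply, Finsupp.sum, Finsupp.sum, Finset.sum_mul]
    exact Finset.sum_congr rfl fun i _ => by rw [smul_mul_assoc, ← charFun_add]; rfl
  rw [e] at hqm
  refine X.charFun_mem_of_linearCombination_mem
    (A := Subalgebra.toSubmodule X.restrictTorus.range)
    (fun t f hf => X.translate_mem_range_restrictTorus t hf) hqm ?_
  rw [Finsupp.mem_support_iff, Finsupp.mapDomain_apply (add_left_injective m)]
  exact Finsupp.mem_support_iff.1 ha

/-- Write `χ^m = p / q` with `p, q` in `ℂ[V]`. If `χ^(km)` extends, then `q^k` divides `p^k`, so by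
normality `q` divides `p`, and the quotient extends `χ^m`. -/
theorem isSaturatedAffineSemigroup_extendingSemigroup (h : IsNormalVariety X.V) :
    X.IsSaturatedAffineSemigroup X.extendingSemigroup := by
  refine ⟨X.fg_extendingSemigroup, fun k m hk hkm => ?_⟩
  have := X.isDomain_addMonoidAlgebra X.extendingSemigroup
  have : IsDomain (CoordRing X.V) := X.semigroupAlgebraEquiv.symm.toMulEquiv.isDomain _
  have : IsIntegrallyClosed (CoordRing X.V) := h
  obtain ⟨_, ⟨q, rfl⟩, hq0, ⟨p, hp⟩⟩ := X.exists_mul_charFun_mem_range m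
  obtain ⟨r, hr⟩ := hkm
  have hq : q ≠ 0 := by
    rintro rfl
    exact hq0 (map_zero _)
  have hdvd : q ^ k ∣ p ^ k := by
    refine ⟨r, X.restrictTorus_injective ?_⟩
    change X.restrictTorus p = X.restrictTorus q * _ at hp
    change X.restrictTorus r = _ at hr
    rw [map_pow, map_mul, map_pow, hp, hr, mul_pow, charFun_nsmul]
  obtain ⟨c, rfl⟩ := (IsIntegrallyClosed.pow_dvd_pow_iff hk.ne').1 hdvd
  refine ⟨c, X.mul_left_cancel_of_isRegularFun
    (X.isRegularFun_of_mem_range_restrictTorus ⟨q, rfl⟩)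
    (X.isRegularFun_of_mem_range_restrictTorus ⟨c, rfl⟩) (X.isRegularFun_charFun m) hq0 ?_⟩
  change X.restrictTorus (q * c) = _ at hp
  rw [map_mul] at hp
  exact hp

theorem EqSpecm.isoSpecm {X : AffineToricVariety s} {S : AddSubmonoid X.M} (h : X.EqSpecm S) :
    X.IsoSpecm S :=
  let ⟨e, _⟩ := h
  ⟨e⟩

theorem isNormalVariety_of_isoSpecm {S : AddSubmonoid X.M} (hS : X.IsSaturatedAffineSemigroup S)
    (h : X.IsoSpecm S) : IsNormalVariety X.V := by
  obtain ⟨n, ⟨Ψ⟩⟩ := X.exists_latticeEquiv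
  obtain ⟨e⟩ := h
  have := X.isIntegrallyClosed_addMonoidAlgebra Ψ hS.2
  exact IsIntegrallyClosed.of_equiv e.toAlgEquiv.toRingEquiv

end AffineToricVariety

end AffineToric

end

theorem mainTheorem5 {s : ℕ} (X : AffineToric.AffineToricVariety s) :
    List.TFAE [
      AffineToric.IsNormalVariety X.V,
      ∃ S : AddSubmonoid X.M, X.IsSaturatedAffineSemigroup S ∧ X.EqSpecm S,
      ∃ S : AddSubmonoid X.M, X.IsSaturatedAffineSemigroup S ∧ X.IsoSpecm S,
      ∃ σ : PointedCone ℝ X.NReal, X.IsRationalCone σ ∧ X.IsStronglyConvex σ ∧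
        X.EqSpecm (X.coneSemigroup σ),
      ∃ σ : PointedCone ℝ X.NReal, X.IsRationalCone σ ∧ X.IsStronglyConvex σ ∧
        X.IsoSpecm (X.coneSemigroup σ)] := by
  -- Condition 4 is the strongest and 3 the weakest of the semigroup and cone conditions, so it
  -- suffices to prove 4 from normality and normality from 3.
  tfae_have 1 → 4 := by
    intro h
    obtain ⟨σ, hσ, hσ', hS⟩ := X.exists_coneSemigroup_eq
      (X.isSaturatedAffineSemigroup_extendingSemigroup h) X.exists_add_mem_extendingSemigroup
    exact ⟨σ, hσ, hσ', hS ▸ X.eqSpecm_extendingSemigroup⟩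
  tfae_have 4 → 2 := fun ⟨σ, hσ, _, h⟩ =>
    ⟨_, X.isSaturatedAffineSemigroup_coneSemigroup hσ, h⟩
  tfae_have 2 → 3 := fun ⟨S, hS, h⟩ => ⟨S, hS, h.isoSpecm⟩
  tfae_have 3 → 1 := fun ⟨_, hS, h⟩ => X.isNormalVariety_of_isoSpecm hS h
  tfae_have 4 → 5 := fun ⟨σ, hσ, hσ', h⟩ => ⟨σ, hσ, hσ', h.isoSpecm⟩
  tfae_have 5 → 3 := fun ⟨σ, hσ, _, h⟩ =>
    ⟨_, X.isSaturatedAffineSemigroup_coneSemigroup hσ, h⟩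
  tfae_finish
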